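/- An additively idempotent semiring (ai-semiring) is a non-empty set $S$ with two binary operations $+$ and $\cdot$ such that $(S,+)$ is a commutative idempotent semigroup, $(S,\cdot)$ is a semigroup, and $x(y+z)=xy+xz$ and $(x+y)z=xz+yz$ hold. A variety is a class of ai-semirings that is closed under subalgebras, homomorphic images and arbitrary direct products (the empty product, a one-element ai-semiring, included); varieties are ordered by inclusion, and $\mathsf{V}(K)$ is the variety generated by $K$. Let $\mathbf{R}$ be the variety of all ai-semirings satisfying the identity $xy\approx xz$, and $\mathbf{T}$ the trivial variety, consisting of the one-element ai-semirings. Let $L_2$, $N_2$, $T_2$ be the ai-semirings on $\{0,1\}$ with $x+y=\max(x,y)$ and with multiplication $xy=x$ in $L_2$, $xy=0$ in $N_2$, $xy=1$ in $T_2$. Let $S_{58}$ be the ai-semiring on $\{1,2,3\}$ in which $x+y$ is the maximum of $x$ and $y$ with respect to the linear order $2<1<3$, and $1\cdot y=3$, $2\cdot y=2$, $3\cdot y=3$ for all $y$. **Theorem 2.7.** The lattice of subvarieties of $\mathbf{R}$ is distributive and has exactly 10 elements, namely $$\mathbf{T},\ \mathsf{V}(L_2),\ \mathsf{V}(N_2),\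 \mathsf{V}(T_2),\ \mathsf{V}(L_2,N_2),\ \mathsf{V}(N_2,T_2),\ \mathsf{V}(L_2,T_2),\ \mathsf{V}(L_2,N_2,T_2),\ \mathsf{V}(S_{58}),\ \mathbf{R}.$$ Its Hasse diagram is as follows; writing $A\prec B$ if $B$ covers $A$, all the covering pairs are - $\mathbf{T}\prec\mathsf{V}(L_2)$, $\mathbf{T}\prec\mathsf{V}(N_2)$, $\mathbf{T}\prec\mathsf{V}(T_2)$; - $\mathsf{V}(L_2)\prec\mathsf{V}(L_2,T_2)$, $\mathsf{V}(L_2)\prec\mathsf{V}(L_2,N_2)$, $\mathsf{V}(T_2)\prec\mathsf{V}(L_2,T_2)$, $\mathsf{V}(T_2)\prec\mathsf{V}(N_2,T_2)$, $\mathsf{V}(N_2)\prec\mathsf{V}(L_2,N_2)$, $\mathsf{V}(N_2)\prec\mathsf{V}(N_2,T_2)$; - $\mathsf{V}(L_2,T_2)\prec\mathsf{V}(S_{58})$, $\mathsf{V}(L_2,T_2)\prec\mathsf{V}(L_2,N_2,T_2)$, $\mathsf{V}(L_2,N_2)\prec\mathsf{V}(L_2,N_2,T_2)$, $\mathsf{V}(N_2,T_2)\prec\mathsf{V}(L_2,N_2,T_2)$;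 - $\mathsf{V}(S_{58})\prec\mathbf{R}$, $\mathsf{V}(L_2,N_2,T_2)\prec\mathbf{R}$. -/

import Mathlib

universe u

/-- An additively idempotent semiring: `(S, +)` is a commutative idempotent semigroup, `(S, *)` is
a semigroup, and both distributive laws hold. There is no zero and no one. -/
class AISemiring (S : Type u) extends AddCommSemigroup S, Semigroup S, Distrib S where
  add_self : ∀ a : S, a + a = a

/-- An ai-semiring with its carrier; as usual for algebras, the carrier is not empty. -/
structure AISem : Type (u + 1) where
  carrier : Type u
  [str : AISemiring carrier]
  [nonempty : Nonempty carrier]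

namespace AISem

instance : CoeSort AISem.{u} (Type u) := ⟨AISem.carrier⟩

instance (S : AISem.{u}) : AISemiring S := S.str

instance (S : AISem.{u}) : Nonempty S := S.nonempty

/-- Homomorphisms of ai-semirings. -/
structure IsHom {S T : AISem.{u}} (f : S → T) : Prop where
  map_add : ∀ a b : S, f (a + b) = f a + f b
  map_mul : ∀ a b : S, f (a * b) = f a * f b

/-- The direct product of a family of ai-semirings, with the operations of each coordinate
(for an empty family this is the one-element ai-semiring). -/
def pi {I : Type u} (S : I → AISem.{u}) : AISem.{u} where
  carrier := ∀ i, S i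
  str :=
    { add := fun a b i => a i + b i
      mul := fun a b i => a i * b i
      add_assoc := fun a b c => funext fun i => add_assoc (a i) (b i) (c i)
      add_comm := fun a b => funext fun i => add_comm (a i) (b i)
      mul_assoc := fun a b c => funext fun i => mul_assoc (a i) (b i) (c i)
      left_distrib := fun a b c => funext fun i => mul_add (a i) (b i) (c i)
      right_distrib := fun a b c => funext fun i => add_mul (a i) (b i) (c i)
      add_self := fun a => funext fun i => AISemiring.add_self (a i) }
  nonempty := ⟨fun i => Classical.choice (S i).nonempty⟩

/-- A class of ai-semirings is a variety if it is closed under subalgebras, homomorphic images and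
arbitrary direct products. Subalgebras are given by injective homomorphisms, homomorphic images
by surjective ones, so that a variety is in particular closed under isomorphism. -/
structure IsVariety (V : Set AISem.{u}) : Prop where
  sub : ∀ (S T : AISem.{u}) (f : T → S), IsHom f → Function.Injective f → S ∈ V → T ∈ V
  image : ∀ (S T : AISem.{u}) (f : S → T), IsHom f → Function.Surjective f → S ∈ V → T ∈ V
  prod : ∀ (I : Type u) (S : I → AISem.{u}), (∀ i, S i ∈ V) → pi S ∈ V

end AISem

/-- Varieties of ai-semirings. -/
structure AIVariety : Type (u + 1) where
  carrier : Set AISem.{u}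
  isVariety : AISem.IsVariety carrier

namespace AIVariety

theorem carrier_injective : Function.Injective AIVariety.carrier.{u} := by
  rintro ⟨V, hV⟩ ⟨W, hW⟩ h
  cases h
  rfl

/-- Varieties are ordered by inclusion. -/
instance : PartialOrder AIVariety.{u} := PartialOrder.lift carrier carrier_injective

/-- The infimum of a set of varieties is their intersection. -/
instance : InfSet AIVariety.{u} where
  sInf 𝒱 :=
    { carrier := {S | ∀ V ∈ 𝒱, S ∈ V.carrier}
      isVariety :=
        { sub := fun S T f hf hi hS V hV => V.isVariety.sub S T f hf hi (hS V hV)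
          image := fun S T f hf hs hS V hV => V.isVariety.image S T f hf hs (hS V hV)
          prod := fun I S hS V hV => V.isVariety.prod I S fun i => hS i V hV } }

/-- The complete lattice of all varieties of ai-semirings. Its order is inclusion, so the meet is
the intersection and the join is the least variety containing the given ones. -/
instance : CompleteLattice AIVariety.{u} :=
  completeLatticeOfInf AIVariety.{u} fun _ =>
    ⟨fun V hV _ hS => hS V hV, fun _ hW _ hS _ hV => hW hV hS⟩

/-- The variety `𝖵(K)` generated by a class `K`: the least variety that contains `K`. -/
def gen (K : Set AISem.{u}) : AIVariety.{u} := sInf {V | K ⊆ V.carrier}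

/-- The trivial variety `𝐓`, consisting of the one-element ai-semirings. -/
def trivialVariety : AIVariety.{u} where
  carrier := {S | Subsingleton S}
  isVariety :=
    { sub := fun _ _ _ _ hi hS => @Function.Injective.subsingleton _ _ _ hi hS
      image := fun _ _ _ _ hs hS => @Function.Surjective.subsingleton _ _ _ hS hs
      prod := fun I S hS => @Pi.instSubsingleton I (fun i => S i) hS }

/-- The variety `𝐑` of the ai-semirings that satisfy the identity `xy ≈ xz`. -/
def varietyR : AIVariety.{u} where
  carrier := {S | ∀ x y z : S, x * y = x * z}
  isVariety :=
    { sub := fun S T f hf hi hS x y z => hi (by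
        rw [hf.map_mul, hf.map_mul]
        exact hS _ _ _)
      image := fun S T f hf hs hS x y z => by
        obtain ⟨a, rfl⟩ := hs x
        obtain ⟨b, rfl⟩ := hs y
        obtain ⟨c, rfl⟩ := hs z
        rw [← hf.map_mul, ← hf.map_mul, hS a b c]
      prod := fun I S hS x y z => funext fun i => hS i (x i) (y i) (z i) }

end AIVariety

namespace AISem

/-- The Cayley tables `A` and `M`, for addition and multiplication on `{0, …, n - 1}`, define an
ai-semiring. -/
abbrev TableLaws {n : ℕ} (A M : Fin n → Fin n → Fin n) : Prop :=
  (∀ a b c, A (A a b) c = A a (A b c)) ∧ (∀ a b, A a b = A b a) ∧ (∀ a, A a a = a) ∧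
    (∀ a b c, M (M a b) c = M a (M b c)) ∧ (∀ a b c, M a (A b c) = A (M a b) (M a c)) ∧
    (∀ a b c, M (A a b) c = A (M a c) (M b c))

/-- The ai-semiring given by Cayley tables; the entry in row `a` and column `b` is the sum, or the
product, of `a` and `b` in this order. The set `{0, …, n - 1}` is lifted to the universe `u`. -/
def ofTables {n : ℕ} [NeZero n] (A M : Fin n → Fin n → Fin n) (h : TableLaws A M) :
    AISem.{u} where
  carrier := ULift.{u} (Fin n)
  str :=
    { add := fun a b => ⟨A a.down b.down⟩
      mul := fun a b => ⟨M a.down b.down⟩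
      add_assoc := fun a b c => congrArg ULift.up (h.1 a.down b.down c.down)
      add_comm := fun a b => congrArg ULift.up (h.2.1 a.down b.down)
      add_self := fun a => congrArg ULift.up (h.2.2.1 a.down)
      mul_assoc := fun a b c => congrArg ULift.up (h.2.2.2.1 a.down b.down c.down)
      left_distrib := fun a b c => congrArg ULift.up (h.2.2.2.2.1 a.down b.down c.down)
      right_distrib := fun a b c => congrArg ULift.up (h.2.2.2.2.2 a.down b.down c.down) }
  nonempty := ⟨⟨0⟩⟩

def L₂ : AISem.{u} :=
  ofTables
    ![![0, 1], ![1, 1]]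
    ![![0, 0], ![1, 1]] (by decide)

def N₂ : AISem.{u} :=
  ofTables
    ![![0, 1], ![1, 1]]
    ![![0, 0], ![0, 0]] (by decide)

def T₂ : AISem.{u} :=
  ofTables
    ![![0, 1], ![1, 1]]
    ![![1, 1], ![1, 1]] (by decide)

/-- The three-element ai-semiring `S₅₈`; its usual elements `1, 2, 3` are written `0, 1, 2`. -/
def S₅₈ : AISem.{u} :=
  ofTables
    ![![0, 0, 2], ![0, 1, 2], ![2, 2, 2]]
    ![![2, 2, 2], ![1, 1, 1], ![2, 2, 2]] (by decide)

end AISem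

open AISem AIVariety

open AISem AIVariety

/-! Write x ≤ c for x + c = c. In an ai-semiring satisfying xy ≈ xz, each element c gives a
homomorphism x ↦ ([x ≰ c], [x² ≰ c]) into the four-element algebra `B₄`, and these homomorphisms
separate points (`isHom_character`, `eq_of_character_eq`). So every member of `𝐑` is a subdirect
product of subalgebras of `B₄`. Up to isomorphism the nontrivial ones are L₂, N₂, T₂, S₅₈, `Q₃` and
`B₄`; here `Q₃` generates the same variety as L₂ and N₂, and `B₄` the same as S₅₈ and N₂. A
subvariety is therefore determined by which of L₂, N₂, T₂, S₅₈ it contains (`le_of_code_subset`).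

The only constraint is that S₅₈ brings along L₂ and T₂: identities show that every set of indices
obeying it occurs (`code_ofCode`). These sets are closed under union and intersection, so the
lattice is distributive, and its size and covers are a finite computation. -/

namespace AISem

/-! ### Closure properties of varieties -/

/-- A homomorphism whose range is that of an injective homomorphism `g` factors through `g`. -/
theorem IsHom.exists_factor {S T X : AISem.{u}} {φ : S → T} (hφ : IsHom φ) {g : X → T}
    (hg : IsHom g) (hinj : Function.Injective g) (hr : Set.range g = Set.range φ) :
    ∃ ψ : S → X, IsHom ψ ∧ Function.Surjective ψ ∧ ∀ x, g (ψ x) = φ x := by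
  have h : ∀ x, ∃ y, g y = φ x := fun x => hr.symm.subset ⟨x, rfl⟩
  choose ψ hψ using h
  refine ⟨ψ, ⟨fun a b => hinj ?_, fun a b => hinj ?_⟩, fun y => ?_, hψ⟩
  · rw [hg.map_add, hψ, hψ, hψ, hφ.map_add]
  · rw [hg.map_mul, hψ, hψ, hψ, hφ.map_mul]
  · obtain ⟨x, hx⟩ := hr.subset ⟨y, rfl⟩
    exact ⟨x, hinj ((hψ x).trans hx)⟩

/-- The empty product has one element and maps onto any other one-element algebra. -/
theorem IsVariety.of_subsingleton {V : Set AISem.{u}} (hV : IsVariety V) (S : AISem.{u})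
    [Subsingleton S] : S ∈ V :=
  hV.image (pi fun i : PEmpty.{u + 1} => i.elim) S (fun _ => Classical.choice S.nonempty)
    ⟨fun _ _ => Subsingleton.elim _ _, fun _ _ => Subsingleton.elim _ _⟩
    (fun _ => ⟨fun i => i.elim, Subsingleton.elim _ _⟩) (hV.prod _ _ fun i => i.elim)

/-- An ai-semiring lies in a variety if homomorphisms to members of the variety separate its
points. -/
theorem IsVariety.of_separating {V : Set AISem.{u}} (hV : IsVariety V) {S : AISem.{u}}
    {I : Type u} (X : I → AISem.{u}) (hX : ∀ i, X i ∈ V) (ψ : ∀ i, S → X i)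
    (hψ : ∀ i, IsHom (ψ i)) (hsep : ∀ x y, (∀ i, ψ i x = ψ i y) → x = y) : S ∈ V :=
  hV.sub (pi X) S (fun x i => ψ i x)
    ⟨fun a b => funext fun i => (hψ i).map_add a b, fun a b => funext fun i => (hψ i).map_mul a b⟩
    (fun x y h => hsep x y fun i => congrFun h i) (hV.prod I X hX)

section Tables

variable {m n k : ℕ} [NeZero m] [NeZero n] [NeZero k]
  {A M : Fin m → Fin m → Fin m} {h : TableLaws A M}
  {A' M' : Fin n → Fin n → Fin n} {h' : TableLaws A' M'}
  {A'' M'' : Fin k → Fin k → Fin k} {h'' : TableLaws A'' M''}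

theorem isHom_ofTables {g : Fin m → Fin n} (hadd : ∀ a b, g (A a b) = A' (g a) (g b))
    (hmul : ∀ a b, g (M a b) = M' (g a) (g b)) :
    IsHom (S := ofTables.{u} A M h) (T := ofTables.{u} A' M' h') fun a => ⟨g a.down⟩ :=
  ⟨fun a b => congrArg ULift.up (hadd a.down b.down),
    fun a b => congrArg ULift.up (hmul a.down b.down)⟩

theorem IsVariety.ofTables_of_injective {V : Set AISem.{u}} (hV : IsVariety V)
    (hmem : ofTables.{u} A' M' h' ∈ V) (g : Fin m → Fin n) (hinj : ∀ a b, g a = g b → a = b)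
    (hadd : ∀ a b, g (A a b) = A' (g a) (g b)) (hmul : ∀ a b, g (M a b) = M' (g a) (g b)) :
    ofTables.{u} A M h ∈ V :=
  hV.sub _ _ _ (isHom_ofTables hadd hmul)
    (fun _ _ hab => ULift.ext _ _ (hinj _ _ (congrArg ULift.down hab))) hmem

/-- Homomorphic images of the product of two members of a variety. -/
theorem IsVariety.ofTables_of_prod {V : Set AISem.{u}} (hV : IsVariety V)
    (hmem : ofTables.{u} A M h ∈ V) (hmem' : ofTables.{u} A' M' h' ∈ V)
    (g : Fin m → Fin n → Fin k) (hsurj : ∀ c, ∃ a b, g a b = c)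
    (hadd : ∀ a b a' b', g (A a a') (A' b b') = A'' (g a b) (g a' b'))
    (hmul : ∀ a b a' b', g (M a a') (M' b b') = M'' (g a b) (g a' b')) :
    ofTables.{u} A'' M'' h'' ∈ V := by
  let X : ULift.{u} Bool → AISem.{u} := fun i =>
    match i with
    | ⟨true⟩ => ofTables A M h
    | ⟨false⟩ => ofTables A' M' h'
  refine hV.image (pi X) _ (fun x => ⟨g (x ⟨true⟩).down (x ⟨false⟩).down⟩)
    ⟨fun x y => congrArg ULift.up (hadd _ _ _ _), fun x y => congrArg ULift.up (hmul _ _ _ _)⟩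
    (fun c => ?_) (hV.prod _ X ?_)
  · obtain ⟨a, b, hab⟩ := hsurj c.down
    exact ⟨fun i =>
      match i with
      | ⟨true⟩ => ⟨a⟩
      | ⟨false⟩ => ⟨b⟩, ULift.ext _ _ hab⟩
  · rintro ⟨_ | _⟩
    exacts [hmem', hmem]

end Tables

/-! ### A four-element generator of `𝐑` and its subalgebras -/

/-- The one-element ai-semiring. -/
def one₁ : AISem.{u} := ofTables ![![0]] ![![0]] (by decide)

/-- The chain `0 < 1 < 2` with `0 * y = 1 * y = 0` and `2 * y = 2`. -/
def Q₃ : AISem.{u} :=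
  ofTables
    ![![0, 1, 2], ![1, 1, 2], ![2, 2, 2]]
    ![![0, 0, 0], ![0, 0, 0], ![2, 2, 2]] (by decide)

/-- The semilattice `{0, 1}²` with `(a, b) * y = (b, b)`; the pair `(a, b)` is written
`a + 2 * b`. -/
def B₄ : AISem.{u} :=
  ofTables
    ![![0, 1, 2, 3], ![1, 1, 3, 3], ![2, 3, 2, 3], ![3, 3, 3, 3]]
    ![![0, 0, 0, 0], ![0, 0, 0, 0], ![3, 3, 3, 3], ![3, 3, 3, 3]] (by decide)

/-! ### Characters into `B₄` and the subalgebras of `B₄` -/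

theorem add_add_eq_right_iff {S : AISem.{u}} (x y c : S) :
    x + y + c = c ↔ x + c = c ∧ y + c = c := by
  refine ⟨fun h => ⟨?_, ?_⟩, fun ⟨h₁, h₂⟩ => by rw [add_assoc, h₂, h₁]⟩
  · rw [← h, ← add_assoc, ← add_assoc, AISemiring.add_self]
  · rw [← h, ← add_assoc, ← add_assoc, add_comm y x, add_assoc x y y, AISemiring.add_self]

open Classical in
/-- The element `([¬ p], [¬ q])` of `B₄`. -/
noncomputable def truthPair (p q : Prop) : Fin 4 :=
  if p then (if q then 0 else 2) else if q then 1 else 3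

theorem truthPair_and (p q p' q' : Prop) :
    truthPair (p ∧ p') (q ∧ q') =
      (![![0, 1, 2, 3], ![1, 1, 3, 3], ![2, 3, 2, 3], ![3, 3, 3, 3]] :
        Fin 4 → Fin 4 → Fin 4) (truthPair p q) (truthPair p' q') := by
  by_cases hp : p <;> by_cases hq : q <;> by_cases hp' : p' <;> by_cases hq' : q' <;>
    simp [truthPair, hp, hq, hp', hq']

theorem truthPair_self (p q : Prop) (i : Fin 4) :
    truthPair q q =
      (![![0, 0, 0, 0], ![0, 0, 0, 0], ![3, 3, 3, 3], ![3, 3, 3, 3]] :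
        Fin 4 → Fin 4 → Fin 4) (truthPair p q) i := by
  by_cases hp : p <;> by_cases hq : q <;> simp only [truthPair, hp, hq, if_true, if_false] <;>
    revert i <;> decide

/-- The map `x ↦ ([x ≰ c], [x * x ≰ c])`. -/
noncomputable def character {S : AISem.{u}} (c : S) (x : S) : B₄.{u} :=
  ⟨truthPair (x + c = c) (x * x + c = c)⟩

/-- Since a product depends only on its left factor, (x + y)² = x² + y² and xy = (xy)² = x². A sum
lies below c exactly when both summands do, so sums go to coordinatewise joins, and xy repeats the
second coordinate of x. -/
theorem isHom_character {S : AISem.{u}} (hS : S ∈ varietyR.carrier) (c : S) :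
    IsHom (character c) := by
  have hS' : ∀ x y z : S, x * y = x * z := hS
  refine ⟨fun x y => ULift.ext _ _ ?_, fun x y => ULift.ext _ _ ?_⟩
  · refine Eq.trans ?_ (truthPair_and _ _ _ _)
    rw [← add_add_eq_right_iff, ← add_add_eq_right_iff]
    change truthPair _ ((x + y) * (x + y) + c = c) = _
    rw [add_mul, hS' x _ x, hS' y _ y]
  · refine Eq.trans ?_ (truthPair_self _ _ _)
    change truthPair _ (x * y * (x * y) + c = c) = _
    have h : x * y * (x * y) = x * x := (mul_assoc _ _ _).trans (hS' _ _ _)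
    rw [h, hS' x y x]

/-- The first coordinate at c = x gives y ≤ x, and at c = y it gives x ≤ y. -/
theorem eq_of_character_eq {S : AISem.{u}} {x y : S}
    (h : ∀ c : S, character c x = character c y) : x = y := by
  have key : ∀ {x y : S}, character x x = character x y → y + x = x := by
    intro x y h
    have h' := congrArg ULift.down h
    by_contra hne
    simp only [character, truthPair, AISemiring.add_self, hne, if_true, if_false] at h'
    split_ifs at h' <;> revert h' <;> decide
  exact (key (h x)).symm.trans ((add_comm y x).trans (key (h y).symm))

/-- The nontrivial proper subalgebras of `B₄` up to isomorphism, with `B₄` and the one-element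
ai-semiring. -/
theorem IsHom.exists_factor_B₄ {S : AISem.{u}} {φ : S → B₄.{u}} (hφ : IsHom φ) :
    ∃ X ∈ ({one₁, L₂, N₂, T₂, S₅₈, Q₃, B₄} : Set AISem.{u}), ∃ ψ : S → X,
      IsHom ψ ∧ Function.Surjective ψ ∧ ∀ x y, ψ x = ψ y → φ x = φ y := by
  classical
  let R : Finset (Fin 4) := Finset.univ.filter fun i => ∃ x, (φ x).down = i
  have hR : ∀ i, i ∈ R ↔ ∃ x, (φ x).down = i := fun i => by simp [R]
  have hne : R ≠ ∅ := by
    obtain ⟨x⟩ := S.nonempty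
    exact Finset.ne_empty_of_mem ((hR _).2 ⟨x, rfl⟩)
  have hadd : ∀ i ∈ R, ∀ j ∈ R,
      (![![0, 1, 2, 3], ![1, 1, 3, 3], ![2, 3, 2, 3], ![3, 3, 3, 3]] :
        Fin 4 → Fin 4 → Fin 4) i j ∈ R := by
    intro i hi j hj
    obtain ⟨x, rfl⟩ := (hR i).1 hi
    obtain ⟨y, rfl⟩ := (hR j).1 hj
    exact (hR _).2 ⟨x + y, congrArg ULift.down (hφ.map_add x y)⟩
  have hmul : ∀ i ∈ R, ∀ j ∈ R,
      (![![0, 0, 0, 0], ![0, 0, 0, 0], ![3, 3, 3, 3], ![3, 3, 3, 3]] :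
        Fin 4 → Fin 4 → Fin 4) i j ∈ R := by
    intro i hi j hj
    obtain ⟨x, rfl⟩ := (hR i).1 hi
    obtain ⟨y, rfl⟩ := (hR j).1 hj
    exact (hR _).2 ⟨x * y, congrArg ULift.down (hφ.map_mul x y)⟩
  have hcases : R = {0} ∨ R = {3} ∨ R = {0, 3} ∨ R = {0, 1} ∨ R = {2, 3} ∨ R = {0, 2, 3} ∨
      R = {0, 1, 3} ∨ R = {0, 1, 2, 3} := by
    -- Once the origin of `R` is forgotten, this is a check over the 16 subsets of `B₄`.
    clear_value R
    clear hR
    revert R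
    decide
  have key : ∀ (X : AISem.{u}) (g : X → B₄.{u}), IsHom g → Function.Injective g →
      (∀ i, i ∈ R ↔ ∃ y, (g y).down = i) → ∃ ψ : S → X,
      IsHom ψ ∧ Function.Surjective ψ ∧ ∀ x y, ψ x = ψ y → φ x = φ y := by
    intro X g hg hinj hr
    obtain ⟨ψ, h₁, h₂, h₃⟩ := hφ.exists_factor hg hinj (by
      ext i
      have h : ∀ {Y : AISem.{u}} (f : Y → B₄.{u}), i ∈ Set.range f ↔ ∃ y, (f y).down = i.down :=
        fun f => exists_congr fun y => ⟨congrArg ULift.down, ULift.ext _ _⟩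
      rw [h, h, ← hr, ← hR])
    exact ⟨ψ, h₁, h₂, fun x y h => by rw [← h₃, ← h₃, h]⟩
  have keyTables : ∀ {n : ℕ} [NeZero n] {A M : Fin n → Fin n → Fin n} {h : TableLaws A M}
      (g : Fin n → Fin 4) (s : Finset (Fin 4)), R = s →
      (∀ a b, g (A a b) =
        (![![0, 1, 2, 3], ![1, 1, 3, 3], ![2, 3, 2, 3], ![3, 3, 3, 3]] :
          Fin 4 → Fin 4 → Fin 4) (g a) (g b)) →
      (∀ a b, g (M a b) =
        (![![0, 0, 0, 0], ![0, 0, 0, 0], ![3, 3, 3, 3], ![3, 3, 3, 3]] :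
          Fin 4 → Fin 4 → Fin 4) (g a) (g b)) →
      (∀ a b, g a = g b → a = b) → (∀ i, i ∈ s ↔ ∃ y, g y = i) →
      ∃ ψ : S → ofTables.{u} A M h,
        IsHom ψ ∧ Function.Surjective ψ ∧ ∀ x y, ψ x = ψ y → φ x = φ y := by
    rintro n _ A M h g s rfl h₁ h₂ h₃ h₄
    refine key _ _ (isHom_ofTables h₁ h₂)
      (fun _ _ hab => ULift.ext _ _ (h₃ _ _ (congrArg ULift.down hab))) fun i => ?_
    exact (h₄ i).trans ⟨fun ⟨y, hy⟩ => ⟨⟨y⟩, hy⟩, fun ⟨y, hy⟩ => ⟨y.down, hy⟩⟩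
  rcases hcases with h | h | h | h | h | h | h | h
  · exact ⟨one₁, by simp,
      keyTables ![0] _ h (by decide) (by decide) (by decide) (by decide)⟩
  · exact ⟨one₁, by simp,
      keyTables ![3] _ h (by decide) (by decide) (by decide) (by decide)⟩
  · exact ⟨L₂, by simp,
      keyTables ![0, 3] _ h (by decide) (by decide) (by decide) (by decide)⟩
  · exact ⟨N₂, by simp,
      keyTables ![0, 1] _ h (by decide) (by decide) (by decide) (by decide)⟩
  · exact ⟨T₂, by simp,
      keyTables ![2, 3] _ h (by decide) (by decide) (by decide) (by decide)⟩
  · exact ⟨S₅₈, by simp,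
      keyTables ![2, 0, 3] _ h (by decide) (by decide) (by decide) (by decide)⟩
  · exact ⟨Q₃, by simp,
      keyTables ![0, 1, 3] _ h (by decide) (by decide) (by decide) (by decide)⟩
  · exact ⟨B₄, by simp,
      keyTables ![0, 1, 2, 3] _ h (by decide) (by decide) (by decide) (by decide)⟩

/-! ### Identities -/

/-- Terms in three variables in the signature of ai-semirings. -/
inductive Term : Type
  | var : Fin 3 → Term
  | add : Term → Term → Term
  | mul : Term → Term → Term

namespace Term

/-- The value of a term under an assignment of the variables. -/
def eval {S : AISem.{u}} (ρ : Fin 3 → S) : Term → S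
  | var i => ρ i
  | add s t => eval ρ s + eval ρ t
  | mul s t => eval ρ s * eval ρ t

theorem map_eval {S T : AISem.{u}} {f : S → T} (hf : IsHom f) (ρ : Fin 3 → S) (t : Term) :
    f (t.eval ρ) = t.eval (f ∘ ρ) := by
  induction t with
  | var i => rfl
  | add s t hs ht => simp only [eval, hf.map_add, hs, ht]
  | mul s t hs ht => simp only [eval, hf.map_mul, hs, ht]

theorem isHom_proj {I : Type u} (S : I → AISem.{u}) (i : I) :
    IsHom (S := pi S) (T := S i) fun x => x i :=
  ⟨fun _ _ => rfl, fun _ _ => rfl⟩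

/-- The variety of the ai-semirings that satisfy the identity `s ≈ t`. -/
def models (s t : Term) : AIVariety.{u} where
  carrier := {S | ∀ ρ : Fin 3 → S, s.eval ρ = t.eval ρ}
  isVariety :=
    { sub := fun _ _ f hf hi hS ρ => hi (by rw [map_eval hf, map_eval hf, hS])
      image := fun S T f hf hs hS ρ => by
        obtain ⟨ρ', rfl⟩ : ∃ ρ' : Fin 3 → S, f ∘ ρ' = ρ :=
          ⟨fun i => (hs (ρ i)).choose, funext fun i => (hs (ρ i)).choose_spec⟩
        rw [← map_eval hf, ← map_eval hf, hS]
      prod := fun _ S hS ρ => funext fun i =>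
        (map_eval (isHom_proj S i) ρ s).trans
          ((hS i fun j => ρ j i).trans (map_eval (isHom_proj S i) ρ t).symm) }

/-- The value of a term in a table algebra. -/
def evalTables {n : ℕ} (A M : Fin n → Fin n → Fin n) (ρ : Fin 3 → Fin n) : Term → Fin n
  | var i => ρ i
  | add s t => A (evalTables A M ρ s) (evalTables A M ρ t)
  | mul s t => M (evalTables A M ρ s) (evalTables A M ρ t)

theorem eval_ofTables {n : ℕ} [NeZero n] {A M : Fin n → Fin n → Fin n} {h : TableLaws A M}
    (ρ : Fin 3 → ofTables.{u} A M h) (t : Term) :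
    t.eval ρ = ⟨t.evalTables A M fun i => (ρ i).down⟩ := by
  induction t with
  | var i => rfl
  | add s t hs ht => simp only [eval, hs, ht]; rfl
  | mul s t hs ht => simp only [eval, hs, ht]; rfl

theorem ofTables_mem_models_iff {n : ℕ} [NeZero n] {A M : Fin n → Fin n → Fin n}
    {h : TableLaws A M} {s t : Term} :
    ofTables.{u} A M h ∈ (models s t).carrier ↔
      ∀ a b c : Fin n, s.evalTables A M ![a, b, c] = t.evalTables A M ![a, b, c] := by
  have hρ : ∀ ρ : Fin 3 → Fin n, ![ρ 0, ρ 1, ρ 2] = ρ := fun ρ => by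
    ext i; fin_cases i <;> rfl
  constructor
  · intro H a b c
    let ρ : Fin 3 → ofTables.{u} A M h := fun i => ⟨(![a, b, c] : Fin 3 → Fin n) i⟩
    exact congrArg ULift.down ((eval_ofTables ρ s).symm.trans ((H ρ).trans (eval_ofTables ρ t)))
  · intro H ρ
    rw [eval_ofTables, eval_ofTables, ← hρ fun i => (ρ i).down, H]

end Term

end AISem

namespace AIVariety

open Term

theorem gen_le_iff {K : Set AISem.{u}} {V : AIVariety.{u}} : gen K ≤ V ↔ K ⊆ V.carrier :=
  ⟨fun h _ hS => h fun _ hW => hW hS, fun h => sInf_le (a := V) h⟩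

theorem subset_gen (K : Set AISem.{u}) : K ⊆ (gen K).carrier := gen_le_iff.1 le_rfl

/-! ### Subvarieties of `𝐑` are determined by the generators they contain -/

/-- The ai-semirings by which the subvarieties of `𝐑` are distinguished. -/
def irred : Fin 4 → AISem.{u} := ![L₂, N₂, T₂, S₅₈]

/-- The join-irreducible varieties below `gen {S₅₈}` have to be present along with it. -/
def Admissible (s : Finset (Fin 4)) : Prop := 3 ∈ s → 0 ∈ s ∧ 2 ∈ s

instance : DecidablePred Admissible := fun s => by unfold Admissible; infer_instance

open Classical in
/-- The indices of those of the four ai-semirings that lie in a variety. -/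
noncomputable def code (V : AIVariety.{u}) : Finset (Fin 4) :=
  Finset.univ.filter fun i => irred i ∈ V.carrier

theorem mem_code {V : AIVariety.{u}} {i : Fin 4} : i ∈ code V ↔ irred i ∈ V.carrier := by
  simp [code]

theorem L₂_mem_of_S₅₈ {V : AIVariety.{u}} (h : S₅₈ ∈ V.carrier) : L₂ ∈ V.carrier :=
  V.isVariety.ofTables_of_injective h ![1, 2] (by decide) (by decide) (by decide)

theorem T₂_mem_of_S₅₈ {V : AIVariety.{u}} (h : S₅₈ ∈ V.carrier) : T₂ ∈ V.carrier :=
  V.isVariety.ofTables_of_injective h ![0, 2] (by decide) (by decide) (by decide)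

/-- L₂ and N₂ embed in `Q₃`. Conversely, the sum of the two embeddings maps L₂ × N₂ onto `Q₃`; it is
multiplicative because products depend only on the left factor and distribute over sums. The same
device serves for `B₄`. -/
theorem Q₃_mem_iff {V : AIVariety.{u}} :
    Q₃ ∈ V.carrier ↔ L₂ ∈ V.carrier ∧ N₂ ∈ V.carrier :=
  ⟨fun h =>
    ⟨V.isVariety.ofTables_of_injective h ![0, 2] (by decide) (by decide) (by decide),
      V.isVariety.ofTables_of_injective h ![0, 1] (by decide) (by decide) (by decide)⟩,
    fun h => V.isVariety.ofTables_of_prod h.1 h.2 ![![0, 1], ![2, 2]]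
      (by decide) (by decide) (by decide)⟩

theorem B₄_mem_iff {V : AIVariety.{u}} :
    B₄ ∈ V.carrier ↔ S₅₈ ∈ V.carrier ∧ N₂ ∈ V.carrier :=
  ⟨fun h =>
    ⟨V.isVariety.ofTables_of_injective h ![2, 0, 3] (by decide) (by decide) (by decide),
      V.isVariety.ofTables_of_injective h ![0, 1] (by decide) (by decide) (by decide)⟩,
    fun h => V.isVariety.ofTables_of_prod h.1 h.2 ![![2, 3], ![0, 1], ![3, 3]]
      (by decide) (by decide) (by decide)⟩

theorem admissible_code (V : AIVariety.{u}) : Admissible (code V) := fun h =>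
  have h := mem_code.1 h
  ⟨mem_code.2 (L₂_mem_of_S₅₈ h), mem_code.2 (T₂_mem_of_S₅₈ h)⟩

theorem code_mono {V W : AIVariety.{u}} (h : V ≤ W) : code V ⊆ code W := fun _ hi =>
  mem_code.2 (h (mem_code.1 hi))

/-- The image of each character of S ∈ V is again in V, and its membership in a variety depends only
on the code; so all these images lie in W, and S is a subdirect product of them. -/
theorem le_of_code_subset {V W : AIVariety.{u}} (hV : V ≤ varietyR) (h : code V ⊆ code W) :
    V ≤ W := by
  intro S hS
  have hmem : ∀ i, irred i ∈ V.carrier → irred i ∈ W.carrier := fun i hi =>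
    mem_code.1 (h (mem_code.2 hi))
  choose X hX ψ hψ hsurj hker using fun c : S => (isHom_character (hV hS) c).exists_factor_B₄
  refine W.isVariety.of_separating X (fun c => ?_) ψ hψ fun x y hxy =>
    eq_of_character_eq fun c => hker c x y (hxy c)
  have hXV : X c ∈ V.carrier := V.isVariety.image S _ _ (hψ c) (hsurj c) hS
  rcases hX c with h' | h' | h' | h' | h' | h' | h' <;> rw [h'] at hXV ⊢
  · have : Subsingleton one₁.{u} := inferInstanceAs (Subsingleton (ULift (Fin 1)))
    exact W.isVariety.of_subsingleton one₁
  · exact hmem 0 hXV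
  · exact hmem 1 hXV
  · exact hmem 2 hXV
  · exact hmem 3 hXV
  · exact Q₃_mem_iff.2 ((Q₃_mem_iff.1 hXV).imp (hmem 0) (hmem 1))
  · exact B₄_mem_iff.2 ((B₄_mem_iff.1 hXV).imp (hmem 3) (hmem 1))

/-! ### Realizing every admissible set; the lattice isomorphism -/

/-- The variety generated by the ai-semirings with indices in `s`. -/
def ofCode (s : Finset (Fin 4)) : AIVariety.{u} := gen (irred '' s)

theorem ofCode_le_iff {s : Finset (Fin 4)} {V : AIVariety.{u}} :
    ofCode s ≤ V ↔ ∀ i ∈ s, irred i ∈ V.carrier := by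
  rw [ofCode, gen_le_iff, Set.image_subset_iff]
  rfl

theorem irred_mem_varietyR (i : Fin 4) : irred.{u} i ∈ varietyR.carrier := by
  have key : ∀ {n : ℕ} [NeZero n] {A M : Fin n → Fin n → Fin n} (h : TableLaws A M),
      (∀ a b c, M a b = M a c) → ofTables.{u} A M h ∈ varietyR.carrier :=
    fun _ h x y z => ULift.ext _ _ (h x.down y.down z.down)
  fin_cases i
  exacts [key (by decide) (by decide), key (by decide) (by decide), key (by decide) (by decide),
    key (by decide) (by decide)]

theorem ofCode_le_varietyR (s : Finset (Fin 4)) : ofCode.{u} s ≤ varietyR :=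
  ofCode_le_iff.2 fun i _ => irred_mem_varietyR i

/-- For each of the four ai-semirings, an identity that fails in it. -/
def excluded : Fin 4 → AIVariety.{u} :=
  ![models (mul (var 0) (var 2)) (mul (var 1) (var 2)),
    models (add (mul (var 0) (var 1)) (var 0)) (mul (var 0) (var 1)),
    models (add (mul (var 0) (var 1)) (var 0)) (var 0),
    models (add (mul (var 0) (var 1)) (var 2))
      (add (mul (var 0) (var 1)) (add (mul (var 2) (var 1)) (var 2)))]

/-- The identities say xz ≈ yz, x ≤ xy, xy ≤ x and xy + z ≈ xy + zy + z. The first and third also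
fail in S₅₈, since it contains L₂ and T₂; there are no other exceptions. -/
theorem irred_mem_excluded_iff (i j : Fin 4) :
    irred.{u} j ∈ (excluded i).carrier ↔ j ≠ i ∧ ¬ (j = 3 ∧ (i = 0 ∨ i = 2)) := by
  fin_cases i <;> fin_cases j <;> 
    exact (ofTables_mem_models_iff (h := by decide)).trans (by decide)

/-- For i ∉ s, the identity excluding i holds in all generators: it could fail otherwise only for
S₅₈ with i = 0 or 2, which admissibility forbids. -/
theorem code_ofCode {s : Finset (Fin 4)} (hs : Admissible s) : code (ofCode.{u} s) = s := by
  refine Finset.Subset.antisymm (fun i hi => ?_) fun i hi =>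
    mem_code.2 (ofCode_le_iff.1 le_rfl i hi)
  by_contra his
  have hle : ofCode.{u} s ≤ excluded i := ofCode_le_iff.2 fun j hj =>
    (irred_mem_excluded_iff i j).2 ⟨fun h => his (h ▸ hj), by
      rintro ⟨rfl, rfl | rfl⟩
      exacts [his (hs hj).1, his (hs hj).2]⟩
  exact ((irred_mem_excluded_iff i i).1 (hle (mem_code.1 hi))).1 rfl

theorem ofCode_code {V : AIVariety.{u}} (hV : V ≤ varietyR) : ofCode (code V) = V :=
  le_antisymm (ofCode_le_iff.2 fun _ hi => mem_code.1 hi)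
    (le_of_code_subset hV (code_ofCode (admissible_code V)).ge)

/-- The admissible sets of indices form a distributive lattice. -/
def admissibleSublattice : Sublattice (Finset (Fin 4)) where
  carrier := {s | Admissible s}
  supClosed' := fun s hs t ht h => by
    rcases Finset.mem_union.1 h with h | h
    · exact ⟨Finset.mem_union_left _ (hs h).1, Finset.mem_union_left _ (hs h).2⟩
    · exact ⟨Finset.mem_union_right _ (ht h).1, Finset.mem_union_right _ (ht h).2⟩
  infClosed' := fun s hs t ht h =>
    have h := Finset.mem_inter.1 h
    ⟨Finset.mem_inter.2 ⟨(hs h.1).1, (ht h.2).1⟩, Finset.mem_inter.2 ⟨(hs h.1).2, (ht h.2).2⟩⟩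

/-- The lattice of subvarieties of `𝐑`. -/
noncomputable def codeIso : Set.Iic varietyR.{u} ≃o admissibleSublattice where
  toFun V := ⟨code V.1, admissible_code V.1⟩
  invFun s := ⟨ofCode s.1, ofCode_le_varietyR s.1⟩
  left_inv V := Subtype.ext (ofCode_code V.2)
  right_inv s := Subtype.ext (code_ofCode s.2)
  map_rel_iff' {V _} := ⟨fun h => le_of_code_subset V.2 h, fun h => code_mono h⟩

theorem ofCode_covBy_iff {s t : Finset (Fin 4)} (hs : Admissible s) (ht : Admissible t) :
    ofCode.{u} s ⋖ ofCode t ↔ s ⊂ t ∧ ∀ r, Admissible r → s ⊂ r → ¬ r ⊂ t := by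
  have hlt : ∀ {s t}, Admissible s → Admissible t → (ofCode.{u} s < ofCode t ↔ s ⊂ t) :=
    fun {s t} hs ht =>
      (codeIso.{u}.symm.lt_iff_lt (x := (⟨s, hs⟩ : admissibleSublattice))
        (y := (⟨t, ht⟩ : admissibleSublattice)))
  refine and_congr (hlt hs ht) ⟨fun h r hr h₁ h₂ => h ((hlt hs hr).2 h₁) ((hlt hr ht).2 h₂),
    fun h V h₁ h₂ => ?_⟩
  -- Any variety strictly in between is itself a subvariety of `𝐑`, hence has a code, so covers may
  -- be tested on codes.
  have hV : V ≤ varietyR := h₂.le.trans (ofCode_le_varietyR t)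
  rw [← ofCode_code hV, hlt hs (admissible_code V)] at h₁
  rw [← ofCode_code hV, hlt (admissible_code V) ht] at h₂
  exact h _ (admissible_code V) h₁ h₂

/-! ### The ten subvarieties -/

theorem ofCode_empty : ofCode.{u} ∅ = trivialVariety :=
  le_antisymm (ofCode_le_iff.2 (by simp)) fun S (hS : Subsingleton S) =>
    (ofCode ∅).isVariety.of_subsingleton S

theorem ofCode_univ : ofCode.{u} {0, 1, 2, 3} = varietyR :=
  le_antisymm (ofCode_le_varietyR _) <| le_of_code_subset le_rfl <| by
    rw [code_ofCode (by decide)]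
    have h : ∀ i : Fin 4, i ∈ ({0, 1, 2, 3} : Finset (Fin 4)) := by decide
    exact fun i _ => h i

theorem ofCode_S₅₈ : ofCode.{u} {0, 2, 3} = gen {S₅₈} := by
  have h : S₅₈ ∈ (gen {S₅₈.{u}}).carrier := subset_gen _ rfl
  refine le_antisymm (ofCode_le_iff.2 ?_) (gen_le_iff.2 ?_)
  · intro i hi
    fin_cases hi
    exacts [L₂_mem_of_S₅₈ h, T₂_mem_of_S₅₈ h, h]
  · rintro _ rfl
    exact ofCode_le_iff.1 le_rfl 3 (by decide)

theorem ofCode_image (s : Finset (Fin 4)) (K : Set AISem.{u}) (h : irred '' s = K) :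
    ofCode s = gen K := by rw [ofCode, h]

theorem ofCode_L₂ : ofCode.{u} {0} = gen {L₂} := ofCode_image _ _ (by simp [irred])
theorem ofCode_N₂ : ofCode.{u} {1} = gen {N₂} := ofCode_image _ _ (by simp [irred])
theorem ofCode_T₂ : ofCode.{u} {2} = gen {T₂} := ofCode_image _ _ (by simp [irred])
theorem ofCode_L₂_N₂ : ofCode.{u} {0, 1} = gen {L₂, N₂} :=
  ofCode_image _ _ (by simp [irred, Set.image_insert_eq])
theorem ofCode_N₂_T₂ : ofCode.{u} {1, 2} = gen {N₂, T₂} :=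
  ofCode_image _ _ (by simp [irred, Set.image_insert_eq])
theorem ofCode_L₂_T₂ : ofCode.{u} {0, 2} = gen {L₂, T₂} :=
  ofCode_image _ _ (by simp [irred, Set.image_insert_eq])
theorem ofCode_L₂_N₂_T₂ : ofCode.{u} {0, 1, 2} = gen {L₂, N₂, T₂} :=
  ofCode_image _ _ (by simp [irred, Set.image_insert_eq])

/-- The admissible sets. -/
def admissibleSets : Finset (Finset (Fin 4)) :=
  {∅, {0}, {1}, {2}, {0, 1}, {1, 2}, {0, 2}, {0, 1, 2}, {0, 2, 3}, {0, 1, 2, 3}}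

theorem mem_admissibleSets : ∀ s, s ∈ admissibleSets ↔ Admissible s := by decide

/-- The covering pairs of admissible sets. -/
def admissibleCovers : Finset (Finset (Fin 4) × Finset (Fin 4)) :=
  {(∅, {0}), (∅, {1}), (∅, {2}), ({0}, {0, 2}), ({0}, {0, 1}), ({2}, {0, 2}), ({2}, {1, 2}),
    ({1}, {0, 1}), ({1}, {1, 2}), ({0, 2}, {0, 2, 3}), ({0, 2}, {0, 1, 2}),
    ({0, 1}, {0, 1, 2}), ({1, 2}, {0, 1, 2}), ({0, 2, 3}, {0, 1, 2, 3}),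
    ({0, 1, 2}, {0, 1, 2, 3})}

theorem mem_admissibleCovers : ∀ s t, (s, t) ∈ admissibleCovers ↔
    (Admissible s ∧ Admissible t) ∧ s ⊂ t ∧ ∀ r, Admissible r → s ⊂ r → ¬ r ⊂ t := by
  decide +kernel

theorem Iic_varietyR_eq : Set.Iic varietyR.{u} = ofCode '' admissibleSets := by
  ext V
  constructor
  · exact fun hV => ⟨code V, (mem_admissibleSets _).2 (admissible_code V), ofCode_code hV⟩
  · rintro ⟨s, -, rfl⟩
    exact ofCode_le_varietyR s

theorem covBy_le_varietyR_eq :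
    {p : AIVariety.{u} × AIVariety.{u} | p.2 ≤ varietyR ∧ p.1 ⋖ p.2} =
      Prod.map ofCode ofCode '' admissibleCovers := by
  ext ⟨V, W⟩
  constructor
  · rintro ⟨hW : W ≤ varietyR, h : V ⋖ W⟩
    have hV : V ≤ varietyR := h.le.trans hW
    refine ⟨(code V, code W), (mem_admissibleCovers _ _).2
      ⟨⟨admissible_code V, admissible_code W⟩, ?_⟩, Prod.ext (ofCode_code hV) (ofCode_code hW)⟩
    rwa [← ofCode_covBy_iff.{u} (admissible_code V) (admissible_code W), ofCode_code hV,
      ofCode_code hW]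
  · rintro ⟨⟨s, t⟩, hst, h⟩
    obtain ⟨⟨hs, ht⟩, hc⟩ := (mem_admissibleCovers s t).1 hst
    cases h
    exact ⟨ofCode_le_varietyR t, (ofCode_covBy_iff hs ht).2 hc⟩

theorem card_Iic_varietyR : Nat.card (Set.Iic varietyR.{u}) = 10 := by
  rw [Nat.card_congr (codeIso.{u}.toEquiv.trans
    (Equiv.subtypeEquivRight fun s => (mem_admissibleSets s).symm)), Nat.card_eq_fintype_card,
    Fintype.card_coe]
  decide

end AIVariety

theorem theorem2p7 :
    -- the lattice of subvarieties of `𝐑` is distributive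
    (∀ A B C : Set.Iic varietyR.{u}, A ⊓ (B ⊔ C) = (A ⊓ B) ⊔ (A ⊓ C)) ∧
    -- it has exactly ten elements
    Nat.card (Set.Iic varietyR.{u}) = 10 ∧
    -- namely the following ones
    Set.Iic varietyR.{u} =
      {trivialVariety, gen {L₂}, gen {N₂}, gen {T₂}, gen {L₂, N₂}, gen {N₂, T₂}, gen {L₂, T₂},
        gen {L₂, N₂, T₂}, gen {S₅₈}, varietyR} ∧
    -- its Hasse diagram: the pairs `(A, B)` of subvarieties such that `B` covers `A`
    {p : AIVariety.{u} × AIVariety.{u} | p.2 ≤ varietyR ∧ p.1 ⋖ p.2} =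
      {(trivialVariety, gen {L₂}), (trivialVariety, gen {N₂}), (trivialVariety, gen {T₂}),
        (gen {L₂}, gen {L₂, T₂}), (gen {L₂}, gen {L₂, N₂}),
        (gen {T₂}, gen {L₂, T₂}), (gen {T₂}, gen {N₂, T₂}),
        (gen {N₂}, gen {L₂, N₂}), (gen {N₂}, gen {N₂, T₂}),
        (gen {L₂, T₂}, gen {S₅₈}), (gen {L₂, T₂}, gen {L₂, N₂, T₂}),
        (gen {L₂, N₂}, gen {L₂, N₂, T₂}), (gen {N₂, T₂}, gen {L₂, N₂, T₂}),
        (gen {S₅₈}, varietyR), (gen {L₂, N₂, T₂}, varietyR)} := by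
  refine ⟨fun A B C => codeIso.injective ?_, card_Iic_varietyR, ?_, ?_⟩
  -- Distributivity is inherited from the lattice of finite index sets.
  · simp only [map_inf, map_sup, inf_sup_left]
  · rw [Iic_varietyR_eq]
    simp only [admissibleSets, Finset.coe_insert, Finset.coe_singleton, Set.image_insert_eq,
      Set.image_singleton, ofCode_empty, ofCode_L₂, ofCode_N₂, ofCode_T₂, ofCode_L₂_N₂,
      ofCode_N₂_T₂, ofCode_L₂_T₂, ofCode_L₂_N₂_T₂, ofCode_S₅₈, ofCode_univ]
  · rw [covBy_le_varietyR_eq]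
    simp only [admissibleCovers, Finset.coe_insert, Finset.coe_singleton, Set.image_insert_eq,
      Set.image_singleton, Prod.map_apply, ofCode_empty, ofCode_L₂, ofCode_N₂, ofCode_T₂,
      ofCode_L₂_N₂, ofCode_N₂_T₂, ofCode_L₂_T₂, ofCode_L₂_N₂_T₂, ofCode_S₅₈, ofCode_univ]
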